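/- Let $\mathbb F=\mathbb F_q$ and let $\mathbb F_{q^m}$ be an extension field of degree $m$, with a fixed $\mathbb F$-basis. Let $G\in\mathbb F_{q^m}^{k\times n}$ have rank $k$ and let $\mathcal C=\mathrm{rowsp}(G)=\{uG\mid u\in\mathbb F_{q^m}^k\}$. Write $\mathcal L(\mathbb F^n)$ for the lattice of $\mathbb F$-subspaces of $\mathbb F^n$, $V^\perp$ for the orthogonal of $V$ with respect to the standard dot product, $\delta$ for the Kronecker delta, and $\left[{a\atop b}\right]_Q$ for the Gaussian binomial coefficient with parameter $Q$ (which is $0$ if $b<0$ or $b>a\ge 0$). A $q$-matroid on a finite-dimensional $\mathbb F$-space $E$ is a map $\rho:\mathcal L(E)\to\mathbb N_0$ with $\rho(V)\le\dim V$, $\rho(V)\le\rho(W)$ whenever $V\le W$, and $\rho(V+W)+\rho(V\cap W)\le\rho(V)+\rho(W)$. Let $\mathcal M_G=(\mathbb F^n,\rho)$ be the $q$-matroid given by $\rho(\mathrm{rowsp}(Y))=\mathrm{rk}_{\mathbb F_{q^m}}(GY^{\mathsf T})$ for matrices $Y$ over $\mathbb F$ with $n$ columns; it has rank $\rho(\mathbb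 F^n)=k$. Its Whitney function is $$R_{\mathcal M_G}=\sum_{V\le\mathbb F^n}x^{k-\rho(V)}y^{\dim V-\rho(V)}=\sum_{i=0}^{k}\sum_{j=0}^{n-k}\nu_{i,j}x^iy^j\in\mathbb Z[x,y],\qquad \nu_{i,j}=\big|\{V\mid \rho(V)=k-i,\ \dim V=k-i+j\}\big|,$$ and $\nu_{i,j}:=0$ for $j\notin\{0,\dots,n-k\}$. For $v\in\mathbb F_{q^m}^n$ let $\mathrm{supp}(v)\le\mathbb F^n$ be the row space of the $m\times n$ matrix over $\mathbb F$ whose columns are the coordinate vectors of $v_1,\dots,v_n$ in the fixed basis. For an $\mathbb F_{q^m}$-subspace $T\le\mathbb F_{q^m}^n$ let $\mathrm{supp}(T)=\sum_{v\in T}\mathrm{supp}(v)$ and $\mathrm{wt}(T)=\dim_{\mathbb F}\mathrm{supp}(T)$. For $0\le t\le k$, $0\le i\le n$ and $V\le\mathbb F^n$ let $A_i^{(t)}$ (resp. $A_V^{(t)}$) be the number of $t$-dimensional $\mathbb F_{q^m}$-subspaces $\mathcal C'\le\mathcal C$ with $\mathrm{wt}(\mathcal C')=i$ (resp. $\mathrm{supp}(\mathcal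 C')=V$). These numbers form the $t$-th higher weight distribution (resp. $t$-th higher support distribution) of $\mathcal C$. Define the integer matrices $$A=\big(A_i^{(t)}\big)_{0\le i\le n,\,0\le t\le k},\quad S=\big(A_V^{(t)}\big)_{V\in\mathcal L(\mathbb F^n),\,0\le t\le k},\quad K=\big(\delta_{k-\rho(V),j}\big)_{V\in\mathcal L(\mathbb F^n),\,0\le j\le k},\quad N=\big(\nu_{i,n-k+i-j}\big)_{0\le i\le k,\,0\le j\le n},$$ $$M=\big(\mu(W,V)\big)_{V,W\in\mathcal L(\mathbb F^n)},\quad P=\big(\delta_{W,V^\perp}\big)_{W,V\in\mathcal L(\mathbb F^n)},\quad F=\Big((-1)^{i-j}q^{\binom{i-j}{2}}\left[{n-j\atop i-j}\right]_q\Big)_{0\le i,j\le n},\quad Q=\Big(\left[{t\atop j}\right]_{q^m}\Big)_{0\le t,j\le k},$$ where the first index is always the row index, the entries of $F$ with $i<j$ are $0$, and $\mu$ is the Möbius function of $\mathcal L(\mathbb F^n)$, that is, $\mu(W,V)=(-1)^{d}q^{\binom d2}$ with $d=\dim V-\dim W$ if $W\le V$, and $\mu(W,V)=0$ otherwise. Then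 $M$, $F$, $Q$ are invertible over $\mathbb Z$, $P^{-1}=P$, and: (a) $S=MPKQ$, and thus $K=PM^{-1}SQ^{-1}$. Consequently $\mathcal M_G$ and the collection of all higher support distributions determine each other: if $G'\in\mathbb F_{q^m}^{k'\times n}$ has rank $k'$, then $\mathcal M_{G'}=\mathcal M_G$ if and only if $k'=k$ and $\mathrm{rowsp}(G')$ and $\mathcal C$ have the same $t$-th higher support distribution for every $0\le t\le k$. (b) $A=FN^{\mathsf T}Q$, and thus $N^{\mathsf T}=F^{-1}AQ^{-1}$. Consequently the Whitney function $R_{\mathcal M_G}$ and the collection of all higher weight distributions determine each other: if $G'\in\mathbb F_{q^m}^{k'\times n}$ has rank $k'$, then $R_{\mathcal M_{G'}}=R_{\mathcal M_G}$ if and only if $k'=k$ and $\mathrm{rowsp}(G')$ and $\mathcal C$ have the same $t$-th higher weight distribution for every $0\le t\le k$. -/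

import Mathlib

noncomputable section

namespace RankMetric

open Module

/-! ### Gaussian binomial coefficients -/

/-- The Gaussian binomial coefficient `[n, k]_q`, by the `q`-Pascal rule. -/
def gaussBinom (q : ℕ) : ℕ → ℕ → ℕ
  | _, 0 => 1
  | 0, _ + 1 => 0
  | n + 1, k + 1 => gaussBinom q n k + q ^ (k + 1) * gaussBinom q n (k + 1)

/-- The product formula
`[n, k]_q = ∏_{i < k} (q^(n-i) - 1) / ∏_{i < k} (q^(i+1) - 1)`, with denominators cleared. -/
theorem gaussBinom_mul_prod (q n k : ℕ) :
    (gaussBinom q n k : ℤ) * ∏ i ∈ Finset.range k, ((q : ℤ) ^ (i + 1) - 1) =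
      ∏ i ∈ Finset.range k, ((q : ℤ) ^ (n - i) - 1) := by
  induction n generalizing k with
  | zero =>
    cases k with
    | zero => simp [gaussBinom]
    | succ k => simp [gaussBinom, Finset.prod_range_succ]
  | succ n ih =>
    cases k with
    | zero => simp [gaussBinom]
    | succ k =>
      have h1 := ih k
      have h2 := ih (k + 1)
      rw [Finset.prod_range_succ, Finset.prod_range_succ] at h2
      rw [Finset.prod_range_succ, Finset.prod_range_succ']
      simp only [Nat.add_sub_add_right, Nat.sub_zero]
      rw [← h1] at h2 ⊢
      simp only [gaussBinom]
      push_cast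
      by_cases hk : k ≤ n
      · have e : (q : ℤ) ^ (n + 1) = (q : ℤ) ^ (k + 1) * (q : ℤ) ^ (n - k) := by
          rw [← pow_add]; congr 1; omega
        rw [e]
        linear_combination ((q : ℤ) ^ (k + 1)) * h2
      · have h0 : (gaussBinom q n k : ℤ) * ∏ i ∈ Finset.range k, ((q : ℤ) ^ (i + 1) - 1) = 0 := by
          rw [h1]
          exact Finset.prod_eq_zero (Finset.mem_range.mpr (not_le.mp hk)) (by simp)
        rw [h0] at h2 ⊢
        linear_combination ((q : ℤ) ^ (k + 1)) * h2 + ((q : ℤ) ^ (k + 1) - 1) * h0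

/-! ### The subspace lattice of a finite vector space -/

section Lattice

variable {F E : Type*} [Field F] [AddCommGroup E] [Module F E]

instance instFintypeSubspaces [Finite E] : Fintype (Submodule F E) := Fintype.ofFinite _

instance instDecidableEqSubspaces : DecidableEq (Submodule F E) := Classical.decEq _

end Lattice

/-! ### `q`-matroids -/

/-- A `q`-matroid with ground space `E`, given by its rank function. -/
@[ext]
structure QMatroid (F E : Type*) [Field F] [AddCommGroup E] [Module F E] where
  /-- the rank function -/
  rk : Submodule F E → ℕ
  rk_le_finrank : ∀ V, rk V ≤ finrank F V
  rk_mono : ∀ V W, V ≤ W → rk V ≤ rk W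
  rk_submodular : ∀ V W, rk (V ⊔ W) + rk (V ⊓ W) ≤ rk V + rk W

namespace QMatroid

variable {F E : Type*} [Field F] [AddCommGroup E] [Module F E]

/-- The rank of a `q`-matroid. -/
def rank (M : QMatroid F E) : ℕ := M.rk ⊤

/-- The Whitney function `∑_V x^(k - ρ(V)) y^(dim V - ρ(V))`, where `k` is the rank of `M`.
The variable `x` is `X 0` and `y` is `X 1`; no subtraction truncates. -/
def whitney [Finite E] (M : QMatroid F E) : MvPolynomial (Fin 2) ℤ :=
  ∑ V : Submodule F E, MvPolynomial.X 0 ^ (M.rank - M.rk V) *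
    MvPolynomial.X 1 ^ (finrank F V - M.rk V)

/-- The coefficients `ν_{i,j}` of the Whitney function of `M`, with `ν_{i,j} = 0` unless
`0 ≤ j ≤ dim E - rank M`. -/
def nu (M : QMatroid F E) (i : ℕ) (j : ℤ) : ℤ :=
  if 0 ≤ j ∧ j ≤ (finrank F E : ℤ) - M.rank then
    (({V : Submodule F E | (M.rk V : ℤ) = (M.rank : ℤ) - i ∧
      (finrank F V : ℤ) = (M.rank : ℤ) - i + j}.ncard : ℕ) : ℤ)
  else 0

end QMatroid

/-! ### Row spaces and represented `q`-matroids -/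

/-- The row space `{u M | u}` of a matrix. -/
def rowsp {R : Type*} [Field R] {k n : ℕ} (M : Matrix (Fin k) (Fin n) R) :
    Submodule R (Fin n → R) :=
  LinearMap.range M.vecMulLinear

section Represented

variable (F : Type*) {L : Type*} [Field F] [Field L] [Algebra F L] {k n : ℕ}

/-- The `F`-linear map `y ↦ G yᵀ` from `F^n` to `L^k`. -/
def mulVecBase (G : Matrix (Fin k) (Fin n) L) : (Fin n → F) →ₗ[F] (Fin k → L) :=
  (G.mulVecLin.restrictScalars F) ∘ₗ (Algebra.linearMap F L).compLeft (Fin n)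

/-- The `L`-span of all `G yᵀ`, `y ∈ V`. If `V = rowsp Y`, it is the column space of `G Yᵀ`. -/
def imageSpan (G : Matrix (Fin k) (Fin n) L) (V : Submodule F (Fin n → F)) :
    Submodule L (Fin k → L) :=
  Submodule.span L (mulVecBase F G '' V)

theorem imageSpan_mono (G : Matrix (Fin k) (Fin n) L) {V W : Submodule F (Fin n → F)}
    (h : V ≤ W) : imageSpan F G V ≤ imageSpan F G W :=
  Submodule.span_mono (Set.image_mono h)

theorem imageSpan_span (G : Matrix (Fin k) (Fin n) L) (s : Set (Fin n → F)) :
    imageSpan F G (Submodule.span F s) = Submodule.span L (mulVecBase F G '' s) := by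
  apply le_antisymm
  · refine Submodule.span_le.mpr ?_
    rintro _ ⟨y, hy, rfl⟩
    have h : Submodule.span F s ≤
        ((Submodule.span L (mulVecBase F G '' s)).restrictScalars F).comap (mulVecBase F G) :=
      Submodule.span_le.mpr fun z hz => Submodule.subset_span ⟨z, hz, rfl⟩
    exact h hy
  · exact Submodule.span_mono (Set.image_mono Submodule.subset_span)

theorem imageSpan_sup (G : Matrix (Fin k) (Fin n) L) (V W : Submodule F (Fin n → F)) :
    imageSpan F G (V ⊔ W) = imageSpan F G V ⊔ imageSpan F G W := by
  have h : V ⊔ W = Submodule.span F ((V : Set (Fin n → F)) ∪ W) := by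
    rw [Submodule.span_union, Submodule.span_eq, Submodule.span_eq]
  rw [h, imageSpan_span, Set.image_union, Submodule.span_union]
  rfl

/-- The `q`-matroid `M_G` on `F^n` represented by `G`: its rank function satisfies
`ρ(rowsp Y) = rk (G Yᵀ)`, see `represented_rk_rowsp`. -/
def represented (G : Matrix (Fin k) (Fin n) L) : QMatroid F (Fin n → F) where
  rk V := finrank L (imageSpan F G V)
  rk_le_finrank V := by
    let b := finBasis F V
    have hV : V = Submodule.span F (Set.range fun i => (b i : Fin n → F)) := by
      have h := congrArg (Submodule.map V.subtype) b.span_eq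
      rw [Submodule.map_span, Submodule.map_top, Submodule.range_subtype, ← Set.range_comp] at h
      exact h.symm
    have h2 : imageSpan F G V =
        Submodule.span L (Set.range fun i => mulVecBase F G (b i : Fin n → F)) := by
      conv_lhs => rw [hV]
      rw [imageSpan_span, ← Set.range_comp]
      rfl
    rw [h2]
    exact (finrank_range_le_card _).trans (by simp)
  rk_mono V W h := Submodule.finrank_mono (imageSpan_mono F G h)
  rk_submodular V W := by
    rw [imageSpan_sup, ← Submodule.finrank_sup_add_finrank_inf_eq (imageSpan F G V)]
    exact Nat.add_le_add_left (Submodule.finrank_mono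
      (le_inf (imageSpan_mono F G inf_le_left) (imageSpan_mono F G inf_le_right))) _

/-- The defining property of the rank function of `M_G`. -/
theorem represented_rk_rowsp (G : Matrix (Fin k) (Fin n) L) {t : ℕ}
    (Y : Matrix (Fin t) (Fin n) F) :
    (represented F G).rk (rowsp Y) = (G * (Y.map (algebraMap F L)).transpose).rank := by
  have h : rowsp Y = Submodule.span F (Set.range Y.row) := range_vecMulLinear Y
  rw [Matrix.rank_eq_finrank_span_cols]
  change finrank L (imageSpan F G (rowsp Y)) = _
  rw [h, imageSpan_span, ← Set.range_comp]
  rfl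

/-- The rank of `M_G` is the rank of `G`. -/
theorem represented_rank (G : Matrix (Fin k) (Fin n) L) : (represented F G).rank = G.rank := by
  have h : rowsp (1 : Matrix (Fin n) (Fin n) F) = ⊤ :=
    LinearMap.range_eq_top.mpr fun v => ⟨v, Matrix.vecMul_one v⟩
  rw [QMatroid.rank, ← h, represented_rk_rowsp]
  simp

end Represented

/-! ### Supports and higher distributions of rank-metric codes -/

section Codes

variable {F L : Type*} [Field F] [Field L] [Algebra F L] {m n : ℕ}

/-- The matrix `Ψ(v)` whose columns are the coordinate vectors of the entries of `v`
with respect to the `F`-basis `b` of `L`. -/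
def coordMatrix (b : Basis (Fin m) F L) (v : Fin n → L) : Matrix (Fin m) (Fin n) F :=
  Matrix.of fun i j => b.repr (v j) i

/-- The support of a vector. -/
def supp (b : Basis (Fin m) F L) (v : Fin n → L) : Submodule F (Fin n → F) :=
  rowsp (coordMatrix b v)

/-- The support of a subspace of `L^n`: the sum of the supports of its elements. -/
def suppSpace (b : Basis (Fin m) F L) (T : Submodule L (Fin n → L)) :
    Submodule F (Fin n → F) :=
  ⨆ v ∈ T, supp b v

/-- The rank weight of a subspace of `L^n`. -/
def wtSpace (b : Basis (Fin m) F L) (T : Submodule L (Fin n → L)) : ℕ :=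
  finrank F (suppSpace b T)

/-- The set `D_t(C)` of all `t`-dimensional subcodes of `C`. -/
def subcodes (C : Submodule L (Fin n → L)) (t : ℕ) : Set (Submodule L (Fin n → L)) :=
  {C' | C' ≤ C ∧ finrank L C' = t}

/-- The number `A_i^(t)`. -/
def weightDist (b : Basis (Fin m) F L) (C : Submodule L (Fin n → L)) (t i : ℕ) : ℕ :=
  {C' ∈ subcodes C t | wtSpace b C' = i}.ncard

/-- The number `A_V^(t)`. -/
def supportDist (b : Basis (Fin m) F L) (C : Submodule L (Fin n → L)) (t : ℕ)
    (V : Submodule F (Fin n → F)) : ℕ :=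
  {C' ∈ subcodes C t | suppSpace b C' = V}.ncard

/-- The matrix `A = (A_i^(t))`, `0 ≤ i ≤ n`, `0 ≤ t ≤ k`. -/
def weightMatrix (b : Basis (Fin m) F L) (C : Submodule L (Fin n → L)) (k : ℕ) :
    Matrix (Fin (n + 1)) (Fin (k + 1)) ℤ :=
  Matrix.of fun i t => (weightDist b C t i : ℤ)

/-- The matrix `S = (A_V^(t))`, `V ≤ F^n`, `0 ≤ t ≤ k`. -/
def supportMatrix (b : Basis (Fin m) F L) (C : Submodule L (Fin n → L)) (k : ℕ) :
    Matrix (Submodule F (Fin n → F)) (Fin (k + 1)) ℤ :=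
  Matrix.of fun V t => (supportDist b C t V : ℤ)

end Codes

/-! ### The matrices `M`, `P`, `F`, `Q`, `K`, `N` -/

section Matrices

variable {F E : Type*} [Field F] [AddCommGroup E] [Module F E]

open Classical in
/-- The Möbius function of the subspace lattice of an `F`-vector space, `|F| = q`:
`μ(W, V) = (-1)^(v-w) q^binom(v-w, 2)` if `W ≤ V`, with `v = dim V` and `w = dim W`,
and `μ(W, V) = 0` otherwise. -/
def moebius (W V : Submodule F E) : ℤ :=
  if W ≤ V then
    (-1) ^ (finrank F V - finrank F W) *
      (Nat.card F : ℤ) ^ (finrank F V - finrank F W).choose 2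
  else 0

variable (F E) in
/-- The matrix `M`, with entry `μ(W, V)` in row `V` and column `W`. -/
def moebiusMatrix : Matrix (Submodule F E) (Submodule F E) ℤ :=
  Matrix.of fun V W => moebius W V

/-- The matrix `P = (δ_{W, V^⊥})_{W, V}`, for a bilinear form on `E`. -/
def perpMatrix (B : LinearMap.BilinForm F E) : Matrix (Submodule F E) (Submodule F E) ℤ :=
  Matrix.of fun W V => if W = B.orthogonal V then 1 else 0

/-- The matrix `K = (δ_{k - ρ(V), j})`, for a `q`-matroid of rank `k`. -/
def rankMatrix (M : QMatroid F E) (k : ℕ) : Matrix (Submodule F E) (Fin (k + 1)) ℤ :=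
  Matrix.of fun V j => if (k : ℤ) - (M.rk V : ℤ) = ((j : ℕ) : ℤ) then 1 else 0

/-- The matrix `N = (ν_{i, n-k+i-j})`, `0 ≤ i ≤ k`, `0 ≤ j ≤ n`, for a `q`-matroid of rank `k` on
an `n`-dimensional ground space. -/
def whitneyMatrix (M : QMatroid F E) (k n : ℕ) : Matrix (Fin (k + 1)) (Fin (n + 1)) ℤ :=
  Matrix.of fun i j => M.nu i ((n : ℤ) - k + (i : ℕ) - (j : ℕ))

/-- The matrix `F = ((-1)^(i-j) q^binom(i-j, 2) [n-j, i-j]_q)`, `0 ≤ i, j ≤ n`; the entries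
with `i < j` vanish. -/
def fMatrix (q n : ℕ) : Matrix (Fin (n + 1)) (Fin (n + 1)) ℤ :=
  Matrix.of fun i j =>
    if j ≤ i then
      (-1) ^ ((i : ℕ) - (j : ℕ)) * (q : ℤ) ^ ((i : ℕ) - (j : ℕ)).choose 2 *
        (gaussBinom q (n - (j : ℕ)) ((i : ℕ) - (j : ℕ)) : ℤ)
    else 0

/-- The matrix `([t, j]_Q)`, `0 ≤ t, j ≤ k`. -/
def qMatrix (Q k : ℕ) : Matrix (Fin (k + 1)) (Fin (k + 1)) ℤ :=
  Matrix.of fun t j => (gaussBinom Q t j : ℤ)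

end Matrices

end RankMetric

end

namespace RankMetric

open Module

/-! ### Gaussian binomial coefficients and subspace counts -/

/-! Fix `V ≤ F^n`. A codeword `uG` has support in `V^⊥` iff it is orthogonal to every `y ∈ V`, i.e.
iff `u` is orthogonal to the `L`-span of the vectors `G yᵀ`, whose dimension is `ρ(V)`. Since `u ↦
uG` is injective, these codewords form a subcode of dimension `k - ρ(V)`, so exactly `[k - ρ(V), t]`
(parameter `q^m`) of the `t`-dimensional subcodes have support in `V^⊥`
(`ncard_subcodes_suppSpace_le_perp`). With the zeta matrix `Z` of the subspace lattice this reads `Z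
S = P K Q`, and Möbius inversion `M = Z⁻¹` gives (a).

For (b), apply `D = (δ_{i, dim V})` to (a). Then `D S = A`; `D M = F D`, because `μ(W, V)` and the
number of `V ≥ W` of a given dimension depend only on dimensions; and `D P K = Nᵀ`, because `⊥`
turns dimension `j` into `n - j`.

The matrices `F` and `Q` are unitriangular, so both identities can be solved for `K` and `Nᵀ`. These
encode the rank function and the Whitney function once `k` is known; `k` is the rank of the
`q`-matroid and also the `x`-degree of the Whitney function. -/

theorem gaussBinom_eq_zero_of_lt (q : ℕ) {n k : ℕ} (h : n < k) : gaussBinom q n k = 0 := by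
  induction n generalizing k with
  | zero =>
    obtain ⟨k, rfl⟩ := Nat.exists_eq_succ_of_ne_zero h.ne'
    rfl
  | succ n ih =>
    obtain ⟨k, rfl⟩ := Nat.exists_eq_succ_of_ne_zero (Nat.ne_zero_of_lt h)
    simp only [gaussBinom]
    rw [ih (by omega), ih (by omega), mul_zero, add_zero]

theorem gaussBinom_zero_right (q n : ℕ) : gaussBinom q n 0 = 1 := by
  cases n <;> rfl

theorem gaussBinom_self (q n : ℕ) : gaussBinom q n n = 1 := by
  induction n with
  | zero => rfl
  | succ n ih => simp [gaussBinom, ih, gaussBinom_eq_zero_of_lt]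

/-- The alternating sum of Gaussian binomial coefficients. -/
theorem sum_neg_one_pow_mul_gaussBinom (q n : ℕ) :
    ∑ d ∈ Finset.range (n + 1), (-1 : ℤ) ^ d * (q : ℤ) ^ d.choose 2 * (gaussBinom q n d : ℤ) =
      if n = 0 then 1 else 0 := by
  cases n with
  | zero => simp [gaussBinom]
  | succ n =>
    -- By the `q`-Pascal rule the terms of positive index telescope as differences of `a`. Since `a
    -- (n + 1) = 0`, what remains is `-a 0 = -1`, which cancels the term of index `0`.
    let a : ℕ → ℤ := fun d => (-1) ^ d * (q : ℤ) ^ (d + 1).choose 2 * (gaussBinom q n d : ℤ)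
    have ha : ∀ d, (-1 : ℤ) ^ (d + 1) * (q : ℤ) ^ (d + 1).choose 2 *
        (gaussBinom q (n + 1) (d + 1) : ℤ) = a (d + 1) - a d := by
      intro d
      have e : (d + 1 + 1).choose 2 = (d + 1).choose 2 + (d + 1) := by
        rw [Nat.choose_succ_succ' (d + 1) 1, Nat.choose_one_right, add_comm]
      simp only [a, e, gaussBinom]
      push_cast
      ring
    rw [Finset.sum_range_succ', Finset.sum_congr rfl fun d _ => ha d, Finset.sum_range_sub]
    simp [a, gaussBinom_eq_zero_of_lt, gaussBinom_zero_right]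

section Counting

variable {F E : Type*} [Field F] [AddCommGroup E] [Module F E]

/-- Linearly independent families, sorted by the subspace that they span. -/
def linearIndependentEquivSigma [Module.Finite F E] (d : ℕ) :
    {s : Fin d → E // LinearIndependent F s} ≃
      Σ U : {U : Submodule F E // finrank F U = d},
        {s : Fin d → U.1 // LinearIndependent F s} where
  toFun s := ⟨⟨Submodule.span F (Set.range s.1), by simpa using finrank_span_eq_card s.2⟩,
    fun i => ⟨s.1 i, Submodule.subset_span ⟨i, rfl⟩⟩, linearIndependent_span s.2⟩
  invFun p := ⟨fun i => (p.2.1 i : E), p.2.2.map' p.1.1.subtype p.1.1.ker_subtype⟩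
  left_inv s := rfl
  right_inv := by
    rintro ⟨⟨U, hU⟩, s, hs⟩
    have h : Submodule.span F (Set.range fun i => (s i : E)) = U := by
      have h1 : Submodule.span F (Set.range s) = ⊤ :=
        hs.span_eq_top_of_card_eq_finrank' (by simp [hU])
      have h2 := congrArg (Submodule.map U.subtype) h1
      rwa [Submodule.map_span, Submodule.map_top, Submodule.range_subtype, ← Set.range_comp] at h2
    -- The span equals `U` only propositionally. Replacing it by a variable `U'` lets the equality
    -- be substituted inside the dependent pair.
    have key : ∀ (U' : Submodule F E) (hU' : finrank F U' = d) (s' : Fin d → U')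
        (hs' : LinearIndependent F s'), U' = U → (∀ i, (s' i : E) = s i) →
        (⟨⟨U', hU'⟩, s', hs'⟩ : Σ U : {U : Submodule F E // finrank F U = d},
          {s : Fin d → U.1 // LinearIndependent F s}) = ⟨⟨U, hU⟩, s, hs⟩ := by
      rintro U' hU' s' hs' rfl h'
      obtain rfl : s' = s := funext fun i => Subtype.ext (h' i)
      rfl
    exact key _ _ _ _ h fun _ => rfl

/-- Factoring `q^n - q^i = q^i (q^(n-i) - 1)` brings the count of linearly independent families into
the shape of `gaussBinom_mul_prod`; `d ≤ n` prevents truncated subtraction. -/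
theorem cast_prod_pow_sub_pow {q n d : ℕ} (hq : 0 < q) (h : d ≤ n) :
    ((∏ i : Fin d, (q ^ n - q ^ (i : ℕ)) : ℕ) : ℤ) =
      (∏ i ∈ Finset.range d, (q : ℤ) ^ i) * ∏ i ∈ Finset.range d, ((q : ℤ) ^ (n - i) - 1) := by
  rw [Fin.prod_univ_eq_prod_range (fun i => q ^ n - q ^ i) d, ← Finset.prod_mul_distrib]
  push_cast
  refine Finset.prod_congr rfl fun i hi => ?_
  have hi' : i ≤ n := (Finset.mem_range.mp hi).le.trans h
  rw [Nat.cast_sub (Nat.pow_le_pow_right hq hi'), mul_sub, mul_one, ← pow_add,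
    Nat.add_sub_cancel' hi']
  push_cast
  rfl

/-- The number of `d`-dimensional subspaces of a finite vector space. -/
theorem ncard_finrank_eq [Finite F] [Module.Finite F E] (d : ℕ) :
    {U : Submodule F E | finrank F U = d}.ncard = gaussBinom (Nat.card F) (finrank F E) d := by
  have : Finite E := Module.finite_of_finite F
  have : Fintype F := Fintype.ofFinite F
  by_cases hd : d ≤ finrank F E
  -- Double counting: every `d`-dimensional subspace has the same number of ordered bases, so the
  -- number of independent `d`-families is that number times the number of subspaces.
  · have h := Nat.card_congr (linearIndependentEquivSigma (F := F) (E := E) d)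
    rw [card_linearIndependent hd, Nat.card_sigma,
      Finset.sum_congr rfl fun U _ => by
        rw [card_linearIndependent (V := U.1) U.2.ge, U.2]] at h
    rw [Finset.sum_const, smul_eq_mul, Finset.card_univ, ← Nat.card_eq_fintype_card,
      ← Nat.card_eq_fintype_card] at h
    have hq1 : 1 < Nat.card F := Finite.one_lt_card
    have hq : 0 < Nat.card F := by omega
    have h' := congrArg (Nat.cast : ℕ → ℤ) h
    rw [Nat.cast_mul, cast_prod_pow_sub_pow hq hd, cast_prod_pow_sub_pow hq le_rfl,
      ← gaussBinom_mul_prod] at h'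
    have e : ∏ i ∈ Finset.range d, ((Nat.card F : ℤ) ^ (d - i) - 1) =
        ∏ i ∈ Finset.range d, ((Nat.card F : ℤ) ^ (i + 1) - 1) := by
      rw [← Finset.prod_range_reflect]
      refine Finset.prod_congr rfl fun i hi => ?_
      have := Finset.mem_range.mp hi
      congr 2
      omega
    rw [e] at h'
    have h1 : ∏ i ∈ Finset.range d, (Nat.card F : ℤ) ^ i ≠ 0 :=
      Finset.prod_ne_zero_iff.mpr fun i _ => pow_ne_zero _ (by exact_mod_cast hq.ne')
    have h2 : ∏ i ∈ Finset.range d, ((Nat.card F : ℤ) ^ (i + 1) - 1) ≠ 0 :=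
      Finset.prod_ne_zero_iff.mpr fun i _ => by
        have : (1 : ℤ) < (Nat.card F : ℤ) ^ (i + 1) :=
          one_lt_pow₀ (by exact_mod_cast hq1) (by omega)
        omega
    have h3 : (gaussBinom (Nat.card F) (finrank F E) d : ℤ) =
        (Nat.card {U : Submodule F E // finrank F U = d} : ℕ) := by
      refine mul_right_cancel₀ (mul_ne_zero h1 h2) ?_
      linear_combination h'
    exact (by exact_mod_cast h3.symm)
  · rw [gaussBinom_eq_zero_of_lt _ (not_le.mp hd), Set.ncard_eq_zero]
    refine Set.eq_empty_of_forall_notMem fun U hU => hd ?_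
    exact hU ▸ Submodule.finrank_le U

/-- The number of `d`-dimensional subspaces of a finite subspace. -/
theorem ncard_le_finrank_eq [Finite F] (D : Submodule F E) [Module.Finite F D] (d : ℕ) :
    {U : Submodule F E | U ≤ D ∧ finrank F U = d}.ncard =
      gaussBinom (Nat.card F) (finrank F D) d := by
  rw [← ncard_finrank_eq, ← Set.ncard_image_of_injective _
    (Submodule.map_injective_of_injective D.subtype_injective)]
  congr 1
  ext U
  constructor
  · rintro ⟨h, rfl⟩
    refine ⟨U.comap D.subtype, ?_, ?_⟩
    · exact (Submodule.comapSubtypeEquivOfLe h).finrank_eq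
    · rw [Submodule.map_comap_subtype, inf_eq_right.mpr h]
  · rintro ⟨U, rfl, rfl⟩
    exact ⟨Submodule.map_subtype_le _ _,
      (Submodule.equivMapOfInjective _ D.subtype_injective U).finrank_eq.symm⟩

/-- The number of subspaces of given dimension that contain a given subspace `W`. -/
theorem ncard_ge_finrank_eq [Finite F] [Module.Finite F E] (W : Submodule F E) (d : ℕ) :
    {U : Submodule F E | W ≤ U ∧ finrank F U = finrank F W + d}.ncard =
      gaussBinom (Nat.card F) (finrank F E - finrank F W) d := by
  have hW : finrank F (E ⧸ W) = finrank F E - finrank F W := W.finrank_quotient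
  rw [← hW, ← ncard_finrank_eq, ← Set.ncard_image_of_injective _
    (Submodule.comap_injective_of_surjective W.mkQ_surjective)]
  -- Subspaces above `W` are the preimages of subspaces of `E ⧸ W`, with dimension shifted by `dim
  -- W`.
  have hf : ∀ U : Submodule F (E ⧸ W), finrank F (U.comap W.mkQ) = finrank F W + finrank F U := by
    intro U
    have h := (W.mkQ.domRestrict (U.comap W.mkQ)).finrank_range_add_finrank_ker
    rw [LinearMap.range_domRestrict, LinearMap.ker_domRestrict, Submodule.ker_mkQ,
      Submodule.map_comap_eq_of_surjective W.mkQ_surjective] at h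
    have h' : finrank F (W.comap (U.comap W.mkQ).subtype) = finrank F W :=
      (Submodule.comapSubtypeEquivOfLe (Submodule.le_comap_mkQ W U)).finrank_eq
    rw [← h, ← h', add_comm]
  congr 1
  ext U
  constructor
  · rintro ⟨h, hd⟩
    have e : (U.map W.mkQ).comap W.mkQ = U := by
      rw [Submodule.comap_map_mkQ, sup_eq_right.mpr h]
    refine ⟨U.map W.mkQ, ?_, e⟩
    have := hf (U.map W.mkQ)
    rw [e] at this
    change finrank F (U.map W.mkQ) = d
    omega
  · rintro ⟨U, rfl, rfl⟩
    exact ⟨Submodule.le_comap_mkQ _ _, hf U⟩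

end Counting

/-! ### Invertibility of the code-independent matrices -/

theorem isUnit_of_isLowerTriangular_of_diag_eq_one {ι R : Type*} [Fintype ι] [LinearOrder ι]
    [CommRing R] {A : Matrix ι ι R} (hA : A.IsLowerTriangular) (hd : ∀ i, A i i = 1) :
    IsUnit A := by
  rw [Matrix.isUnit_iff_isUnit_det, Matrix.det_of_isLowerTriangular A hA,
    Finset.prod_eq_one fun i _ => hd i]
  exact isUnit_one

theorem isUnit_fMatrix (q n : ℕ) : IsUnit (fMatrix q n) := by
  refine isUnit_of_isLowerTriangular_of_diag_eq_one (fun i j hij => ?_) fun i => ?_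
  · exact if_neg (not_le.mpr hij)
  · simp [fMatrix, gaussBinom_zero_right]

theorem isUnit_qMatrix (Q k : ℕ) : IsUnit (qMatrix Q k) := by
  refine isUnit_of_isLowerTriangular_of_diag_eq_one (fun i j hij => ?_) fun i => ?_
  · have h : (i : ℕ) < j := hij
    simp [qMatrix, gaussBinom_eq_zero_of_lt _ h]
  · simp [qMatrix, gaussBinom_self]

/-! ### Möbius inversion on the subspace lattice. -/

section Moebius

variable {F E : Type*} [Field F] [AddCommGroup E] [Module F E]

/-- The number of subspaces of given dimension between `W` and `V`. -/
theorem ncard_Icc_finrank_eq [Finite F] [Module.Finite F E] {W V : Submodule F E} (h : W ≤ V)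
    (d : ℕ) :
    {U : Submodule F E | (W ≤ U ∧ U ≤ V) ∧ finrank F U = finrank F W + d}.ncard =
      gaussBinom (Nat.card F) (finrank F V - finrank F W) d := by
  have hW : finrank F (W.comap V.subtype) = finrank F W :=
    (Submodule.comapSubtypeEquivOfLe h).finrank_eq
  rw [← hW, ← ncard_ge_finrank_eq, hW, ← Set.ncard_image_of_injective _
    (Submodule.map_injective_of_injective V.subtype_injective)]
  congr 1
  ext U
  constructor
  · rintro ⟨⟨h1, h2⟩, h3⟩
    refine ⟨U.comap V.subtype, ⟨Submodule.comap_mono h1, ?_⟩, ?_⟩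
    · rw [← h3]
      exact (Submodule.comapSubtypeEquivOfLe h2).finrank_eq
    · rw [Submodule.map_comap_subtype, inf_eq_right.mpr h2]
  · rintro ⟨U, ⟨h1, h2⟩, rfl⟩
    refine ⟨⟨?_, Submodule.map_subtype_le _ _⟩, ?_⟩
    · have := Submodule.map_mono (f := V.subtype) h1
      rwa [Submodule.map_comap_subtype, inf_eq_right.mpr h] at this
    · rw [← h2]
      exact (Submodule.equivMapOfInjective _ V.subtype_injective U).finrank_eq.symm

variable (F E) in
open Classical in
/-- The zeta matrix of the subspace lattice, with entry `1` in row `V` and column `W` if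
`W ≤ V`. -/
noncomputable def zetaMatrix : Matrix (Submodule F E) (Submodule F E) ℤ :=
  Matrix.of fun V W => if W ≤ V then 1 else 0

/-- The entry at `(V, W)` sums `μ(W, U)` over the interval `[W, V]`. Sorted by `dim U - dim W`, this
is the alternating sum of Gaussian binomials, which vanishes unless `dim V = dim W`. -/
theorem zetaMatrix_mul_moebiusMatrix [Finite F] [Finite E] :
    zetaMatrix F E * moebiusMatrix F E = 1 := by
  classical
  ext V W
  rw [Matrix.mul_apply]
  simp only [zetaMatrix, moebiusMatrix, moebius, Matrix.of_apply, ite_mul, one_mul, zero_mul,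
    ← ite_and]
  by_cases h : W ≤ V
  · let g : ℕ → ℤ := fun d => (-1) ^ d * (Nat.card F : ℤ) ^ d.choose 2
    have hdim : finrank F W ≤ finrank F V := Submodule.finrank_mono h
    have hmaps : ∀ U ∈ Finset.univ.filter fun U : Submodule F E => U ≤ V ∧ W ≤ U,
        finrank F U - finrank F W ∈ Finset.range (finrank F V - finrank F W + 1) := by
      intro U hU
      have := Submodule.finrank_mono (Finset.mem_filter.mp hU).2.1
      exact Finset.mem_range.mpr (by omega)
    rw [← Finset.sum_filter, ← Finset.sum_fiberwise_of_maps_to hmaps]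
    have key : ∀ d ∈ Finset.range (finrank F V - finrank F W + 1),
        ∑ U ∈ (Finset.univ.filter fun U : Submodule F E => U ≤ V ∧ W ≤ U).filter
            fun U : Submodule F E => finrank F U - finrank F W = d,
          (-1 : ℤ) ^ (finrank F U - finrank F W) *
            (Nat.card F : ℤ) ^ (finrank F U - finrank F W).choose 2 =
        g d * (gaussBinom (Nat.card F) (finrank F V - finrank F W) d : ℤ) := by
      intro d _
      rw [Finset.sum_congr rfl (g := fun _ => g d) fun U hU => by
          rw [(Finset.mem_filter.mp hU).2], Finset.sum_const, nsmul_eq_mul, mul_comm,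
        ← ncard_Icc_finrank_eq h, ← Set.ncard_coe_finset]
      congr 3
      ext U
      simp only [Finset.coe_filter, Finset.mem_filter, Finset.mem_univ, true_and,
        Set.mem_ofPred_eq]
      constructor
      · rintro ⟨⟨h1, h2⟩, h3⟩
        have := Submodule.finrank_mono h2
        exact ⟨⟨h2, h1⟩, by omega⟩
      · rintro ⟨⟨h1, h2⟩, h3⟩
        exact ⟨⟨h2, h1⟩, by omega⟩
    rw [Finset.sum_congr rfl key, sum_neg_one_pow_mul_gaussBinom, Matrix.one_apply]
    refine if_congr ⟨fun h0 => ?_, fun h0 => ?_⟩ rfl rfl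
    · exact (Submodule.eq_of_le_of_finrank_le h (by omega)).symm
    · rw [h0, Nat.sub_self]
  · rw [Matrix.one_apply_ne fun h' => h h'.ge]
    exact Finset.sum_eq_zero fun U _ => if_neg fun hU => h (hU.2.trans hU.1)

theorem moebiusMatrix_mul_zetaMatrix [Finite F] [Finite E] :
    moebiusMatrix F E * zetaMatrix F E = 1 :=
  mul_eq_one_comm.mp zetaMatrix_mul_moebiusMatrix

theorem isUnit_moebiusMatrix [Finite F] [Finite E] : IsUnit (moebiusMatrix F E) :=
  IsUnit.of_mul_eq_one _ moebiusMatrix_mul_zetaMatrix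

end Moebius

/-! ### Orthogonal spaces for the standard dot product. -/

section Perp

variable {K : Type*} [Field K] {n : ℕ}

variable (K n) in
/-- The standard dot product on `K^n`. -/
abbrev dotForm : LinearMap.BilinForm K (Fin n → K) := dotProductBilin K K

theorem dotForm_isSymm : (dotForm K n).IsSymm :=
  ⟨fun x y => dotProduct_comm x y⟩

theorem dotForm_nondegenerate : (dotForm K n).Nondegenerate := by
  refine ⟨fun x hx => dotProduct_eq_zero_iff.mp hx, fun x hx => dotProduct_eq_zero_iff.mp ?_⟩
  exact fun y => (dotProduct_comm x y).trans (hx y)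

theorem perp_perp (V : Submodule K (Fin n → K)) :
    (dotForm K n).orthogonal ((dotForm K n).orthogonal V) = V :=
  LinearMap.BilinForm.orthogonal_orthogonal dotForm_nondegenerate dotForm_isSymm.isRefl V

theorem finrank_perp (V : Submodule K (Fin n → K)) :
    finrank K ((dotForm K n).orthogonal V) = n - finrank K V := by
  rw [LinearMap.BilinForm.finrank_orthogonal dotForm_nondegenerate, finrank_fin_fun]

/-- As `⊥` is an involution, `P` is a permutation matrix and only permutes rows. -/
theorem perpMatrix_mul_apply [Finite K] {τ : Type*}
    (X : Matrix (Submodule K (Fin n → K)) τ ℤ) (V : Submodule K (Fin n → K)) (t : τ) :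
    (perpMatrix (dotForm K n) * X) V t = X ((dotForm K n).orthogonal V) t := by
  rw [Matrix.mul_apply, Finset.sum_eq_single ((dotForm K n).orthogonal V)]
  · simp [perpMatrix, perp_perp]
  · intro W _ hW
    have : V ≠ (dotForm K n).orthogonal W := by
      rintro rfl
      exact hW (perp_perp W).symm
    simp [perpMatrix, this]
  · simp

theorem perpMatrix_mul_perpMatrix [Finite K] :
    perpMatrix (dotForm K n) * perpMatrix (dotForm K n) = 1 := by
  ext V W
  simp [perpMatrix, Matrix.mul_apply, Matrix.one_apply, perp_perp]

end Perp

/-! ### Counting subcodes by support -/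

section Codes

variable {F L : Type*} [Field F] [Field L] [Algebra F L] {m k n : ℕ}

/-- The entries of `y` lie in `F`, so the `b`-coordinates of `y · v` are the dot products of `y`
with the rows of the coordinate matrix, and these rows span the support. -/
theorem supp_le_perp_iff (b : Basis (Fin m) F L) (v : Fin n → L)
    (V : Submodule F (Fin n → F)) :
    supp b v ≤ (dotForm F n).orthogonal V ↔
      ∀ y ∈ V, (fun j => algebraMap F L (y j)) ⬝ᵥ v = 0 := by
  have hrow : ∀ y : Fin n → F, ((fun j => algebraMap F L (y j)) ⬝ᵥ v = 0) ↔
      ∀ i, y ⬝ᵥ coordMatrix b v i = 0 := by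
    intro y
    rw [← b.repr.map_eq_zero_iff, Finsupp.ext_iff]
    refine forall_congr' fun i => ?_
    simp [dotProduct, coordMatrix, ← Algebra.smul_def, Finsupp.finsetSum_apply]
  have hspan : supp b v = Submodule.span F (Set.range (coordMatrix b v).row) :=
    range_vecMulLinear _
  rw [hspan, Submodule.span_le]
  simp only [hrow]
  constructor
  · intro h y hy i
    exact h ⟨i, rfl⟩ y hy
  · rintro h _ ⟨i, rfl⟩ y hy
    exact h y hy i

theorem suppSpace_le_perp_iff (b : Basis (Fin m) F L) (T : Submodule L (Fin n → L))
    (V : Submodule F (Fin n → F)) :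
    suppSpace b T ≤ (dotForm F n).orthogonal V ↔
      ∀ v ∈ T, ∀ y ∈ V, (fun j => algebraMap F L (y j)) ⬝ᵥ v = 0 := by
  simp only [suppSpace, iSup_le_iff, supp_le_perp_iff]

/-- This is the adjunction `(G yᵀ) · u = y · (uG)`. Orthogonality to `u` is an `L`-linear condition,
so it passes from the vectors `G yᵀ` to their span. -/
theorem mem_perp_imageSpan_iff (G : Matrix (Fin k) (Fin n) L) (V : Submodule F (Fin n → F))
    (u : Fin k → L) :
    u ∈ (dotForm L k).orthogonal (imageSpan F G V) ↔
      ∀ y ∈ V, (fun j => algebraMap F L (y j)) ⬝ᵥ Matrix.vecMul u G = 0 := by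
  have hy : ∀ y : Fin n → F, mulVecBase F G y ⬝ᵥ u =
      (fun j => algebraMap F L (y j)) ⬝ᵥ Matrix.vecMul u G := by
    intro y
    rw [dotProduct_comm, dotProduct_comm _ (Matrix.vecMul u G), ← Matrix.dotProduct_mulVec]
    rfl
  constructor
  · intro h y hyV
    rw [← hy]
    exact h _ (Submodule.subset_span ⟨y, hyV, rfl⟩)
  · intro h x hx
    have hle : imageSpan F G V ≤ LinearMap.ker ((dotForm L k).flip u) := by
      refine Submodule.span_le.mpr ?_
      rintro _ ⟨y, hyV, rfl⟩
      exact (hy y).trans (h y hyV)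
    exact hle hx

theorem vecMulLinear_injective {G : Matrix (Fin k) (Fin n) L} (hG : G.rank = k) :
    Function.Injective G.vecMulLinear := by
  refine Matrix.vecMul_injective_iff.mpr ?_
  rw [linearIndependent_iff_card_eq_finrank_span, Set.finrank, ← Matrix.rank_eq_finrank_span_row,
    hG, Fintype.card_fin]

/-- The subcodes of given dimension supported in `V^⊥` are counted by a Gaussian binomial. -/
theorem ncard_subcodes_suppSpace_le_perp [Finite F] (b : Basis (Fin m) F L)
    {G : Matrix (Fin k) (Fin n) L} (hG : G.rank = k) (t : ℕ) (V : Submodule F (Fin n → F)) :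
    {C' ∈ subcodes (rowsp G) t |
      suppSpace b C' ≤ (dotForm F n).orthogonal V}.ncard =
      gaussBinom (Nat.card F ^ m) (k - (represented F G).rk V) t := by
  have : Module.Finite F L := Module.Finite.of_basis b
  have : Finite L := Module.finite_of_finite F
  have hcard : Nat.card L = Nat.card F ^ m := by
    rw [Module.natCard_eq_pow_finrank (K := F), finrank_eq_card_basis b, Fintype.card_fin]
  -- `D` consists of all codewords with support in `V^⊥`; the subcodes in question are exactly its
  -- `t`-dimensional subspaces.
  let D := ((dotForm L k).orthogonal (imageSpan F G V)).map
    G.vecMulLinear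
  have hD : finrank L D = k - (represented F G).rk V :=
    (Submodule.equivMapOfInjective _ (vecMulLinear_injective hG) _).finrank_eq.symm.trans
      (finrank_perp _)
  rw [← hcard, ← hD, ← ncard_le_finrank_eq D t]
  congr 1
  ext C'
  simp only [subcodes, Set.mem_ofPred_eq, suppSpace_le_perp_iff]
  constructor
  · rintro ⟨⟨h1, h2⟩, h3⟩
    refine ⟨fun v hv => ?_, h2⟩
    obtain ⟨u, rfl⟩ := h1 hv
    exact ⟨u, (mem_perp_imageSpan_iff G V u).mpr (h3 _ hv), rfl⟩
  · rintro ⟨h1, h2⟩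
    refine ⟨⟨fun v hv => ?_, h2⟩, fun v hv => ?_⟩
    · obtain ⟨u, -, rfl⟩ := h1 hv
      exact ⟨u, rfl⟩
    · obtain ⟨u, hu, rfl⟩ := h1 hv
      exact (mem_perp_imageSpan_iff G V u).mp hu

theorem sum_ncard_fiber {α β : Type*} [Finite α] (s : Set α) (f : α → β) (r : Finset β) :
    ∑ x ∈ r, {a ∈ s | f a = x}.ncard = {a ∈ s | f a ∈ r}.ncard := by
  classical
  have : Fintype α := Fintype.ofFinite α
  have h : ∀ (p : α → Prop) [DecidablePred p],
      {a ∈ s | p a}.ncard = (Finset.univ.filter fun a => a ∈ s ∧ p a).card :=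
    fun p => by intro; rw [← Set.ncard_coe_finset]; congr 1; ext; simp
  rw [h, Finset.card_eq_sum_card_fiberwise (f := f) (t := r)
    (by intro a ha; simpa using (Finset.mem_filter.mp ha).2.2)]
  refine Finset.sum_congr rfl fun x hx => ?_
  rw [h, Finset.filter_filter]
  congr 1
  ext a
  simp only [Finset.mem_filter, Finset.mem_univ, true_and]
  constructor
  · rintro ⟨h1, rfl⟩
    exact ⟨⟨h1, hx⟩, rfl⟩
  · rintro ⟨⟨h1, -⟩, rfl⟩
    exact ⟨h1, rfl⟩

theorem represented_rk_le (G : Matrix (Fin k) (Fin n) L) (V : Submodule F (Fin n → F)) :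
    (represented F G).rk V ≤ k :=
  (Submodule.finrank_le (imageSpan F G V)).trans (by simp)

/-- Row `V` of `K` is the unit vector at position `k - ρ(V)`, so it selects that row of `Q`. -/
theorem rankMatrix_mul_qMatrix_apply (G : Matrix (Fin k) (Fin n) L) (Q : ℕ)
    (V : Submodule F (Fin n → F)) (t : Fin (k + 1)) :
    (rankMatrix (represented F G) k * qMatrix Q k) V t =
      (gaussBinom Q (k - (represented F G).rk V) t : ℤ) := by
  have hle := represented_rk_le G V
  rw [Matrix.mul_apply, Finset.sum_eq_single
    (⟨k - (represented F G).rk V, by omega⟩ : Fin (k + 1))]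
  · simp [rankMatrix, qMatrix, Nat.cast_sub hle]
  · intro j _ hj
    have : ¬ (k : ℤ) - ((represented F G).rk V : ℤ) = ((j : ℕ) : ℤ) := by
      intro h
      refine hj (Fin.ext ?_)
      simp only
      omega
    simp [rankMatrix, this]
  · simp

/-- Both sides count the subcodes with support contained in `V`: the left by their exact support,
the right by the Gaussian binomial for `V^⊥`, using `V^⊥⊥ = V`. -/
theorem zetaMatrix_mul_supportMatrix [Finite F] (b : Basis (Fin m) F L)
    {G : Matrix (Fin k) (Fin n) L} (hG : G.rank = k) :
    zetaMatrix F (Fin n → F) * supportMatrix b (rowsp G) k =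
      perpMatrix (dotForm F n) * (rankMatrix (represented F G) k *
        qMatrix (Nat.card F ^ m) k) := by
  classical
  have : Module.Finite F L := Module.Finite.of_basis b
  have : Finite L := Module.finite_of_finite F
  ext V t
  rw [perpMatrix_mul_apply, rankMatrix_mul_qMatrix_apply,
    ← ncard_subcodes_suppSpace_le_perp b hG, perp_perp, Matrix.mul_apply]
  simp only [zetaMatrix, supportMatrix, supportDist, Matrix.of_apply, ite_mul, one_mul, zero_mul]
  rw [← Finset.sum_filter]
  have h := sum_ncard_fiber (subcodes (rowsp G) t) (suppSpace b)
    (Finset.univ.filter fun W => W ≤ V)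
  simp only [Finset.mem_filter, Finset.mem_univ, true_and] at h
  exact_mod_cast h

theorem supportMatrix_eq [Finite F] (b : Basis (Fin m) F L)
    {G : Matrix (Fin k) (Fin n) L} (hG : G.rank = k) :
    supportMatrix b (rowsp G) k = moebiusMatrix F (Fin n → F) *
      perpMatrix (dotForm F n) * rankMatrix (represented F G) k *
        qMatrix (Nat.card F ^ m) k := by
  rw [← Matrix.one_mul (supportMatrix b (rowsp G) k), ← moebiusMatrix_mul_zetaMatrix,
    Matrix.mul_assoc, zetaMatrix_mul_supportMatrix b hG]
  simp only [Matrix.mul_assoc]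

end Codes

/-! ### Whitney functions -/

namespace QMatroid

variable {F E : Type*} [Field F] [AddCommGroup E] [Module F E]

theorem rk_le_rank (M : QMatroid F E) (V : Submodule F E) : M.rk V ≤ M.rank :=
  M.rk_mono V ⊤ le_top

/-- For a complement `W` of `V`, submodularity gives `ρ(E) ≤ ρ(V) + ρ(W) ≤ ρ(V) + dim W`. This
bounds the `y`-exponents of the Whitney function by `dim E - rank`. -/
theorem rank_add_finrank_le [Module.Finite F E] (M : QMatroid F E) (V : Submodule F E) :
    M.rank + finrank F V ≤ M.rk V + finrank F E := by
  obtain ⟨W, hW⟩ := V.exists_isCompl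
  have h1 := M.rk_submodular V W
  have h2 := M.rk_le_finrank W
  have h3 := Submodule.finrank_add_eq_of_isCompl hW
  rw [hW.sup_eq_top] at h1
  simp only [rank]
  omega

/-- The condition in the definition of `ν_{i,j}` is automatic. -/
theorem nu_eq_ncard [Module.Finite F E] (M : QMatroid F E) (i : ℕ) (j : ℤ) :
    M.nu i j = ({V : Submodule F E | (M.rk V : ℤ) = (M.rank : ℤ) - i ∧
      (finrank F V : ℤ) = (M.rank : ℤ) - i + j}.ncard : ℕ) := by
  rw [nu]
  split_ifs with h
  · rfl
  · symm
    rw [Nat.cast_eq_zero]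
    convert Set.ncard_empty (Submodule F E)
    refine Set.eq_empty_of_forall_notMem ?_
    rintro V ⟨h1, h2⟩
    have h3 := M.rank_add_finrank_le V
    have h4 := M.rk_le_finrank V
    omega

theorem coeff_whitney [Finite E] (M : QMatroid F E) (d : Fin 2 →₀ ℕ) :
    M.whitney.coeff d = ({V : Submodule F E | M.rank - M.rk V = d 0 ∧
      finrank F V - M.rk V = d 1}.ncard : ℕ) := by
  classical
  have hmon : ∀ a c : ℕ, (MvPolynomial.X 0 ^ a * MvPolynomial.X 1 ^ c : MvPolynomial (Fin 2) ℤ) =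
      MvPolynomial.monomial (Finsupp.single 0 a + Finsupp.single 1 c) 1 := by
    intro a c
    rw [MvPolynomial.X_pow_eq_monomial, MvPolynomial.X_pow_eq_monomial,
      MvPolynomial.monomial_mul, one_mul]
  have hd : ∀ a c : ℕ, Finsupp.single 0 a + Finsupp.single 1 c = d ↔ a = d 0 ∧ c = d 1 := by
    intro a c
    simp [Finsupp.ext_iff, Fin.forall_fin_two]
  simp only [whitney, MvPolynomial.coeff_sum, hmon, MvPolynomial.coeff_monomial, hd]
  rw [Finset.sum_boole, ← Set.ncard_coe_finset]
  congr 2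
  ext V
  simp

theorem coeff_whitney_eq_nu [Finite E] [Module.Finite F E] (M : QMatroid F E) (d : Fin 2 →₀ ℕ) :
    M.whitney.coeff d = M.nu (d 0) (d 1) := by
  rw [coeff_whitney, nu_eq_ncard]
  congr 3
  ext V
  have h1 := M.rk_le_rank V
  have h2 := M.rk_le_finrank V
  omega

/-- The zero space contributes `x^rank` to the Whitney function, no larger power of `x` occurs, and
all coefficients are nonnegative counts, so nothing cancels. -/
theorem rank_le_of_whitney_eq [Finite E] {M M' : QMatroid F E} (h : M'.whitney = M.whitney) :
    M'.rank ≤ M.rank := by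
  by_contra hlt
  have h0 := congrArg (MvPolynomial.coeff (Finsupp.single 0 M'.rank)) h
  rw [coeff_whitney, coeff_whitney, Nat.cast_inj] at h0
  have h1 : {V : Submodule F E | M.rank - M.rk V = Finsupp.single (0 : Fin 2) M'.rank 0 ∧
      finrank F V - M.rk V = Finsupp.single (0 : Fin 2) M'.rank 1} = ∅ := by
    refine Set.eq_empty_of_forall_notMem fun V hV => hlt ?_
    have := hV.1
    rw [Finsupp.single_eq_same] at this
    omega
  rw [h1, Set.ncard_empty, Set.ncard_eq_zero] at h0
  have h2 : (⊥ : Submodule F E) ∈ (∅ : Set (Submodule F E)) := by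
    rw [← h0]
    have := M'.rk_le_finrank ⊥
    rw [finrank_bot] at this
    refine ⟨?_, ?_⟩
    · rw [Finsupp.single_eq_same]
      omega
    · rw [finrank_bot]
      simp
  exact h2

theorem rank_eq_of_whitney_eq [Finite E] {M M' : QMatroid F E} (h : M'.whitney = M.whitney) :
    M'.rank = M.rank :=
  (rank_le_of_whitney_eq h).antisymm (rank_le_of_whitney_eq h.symm)

/-- The Whitney function and the matrix of its coefficients determine each other. -/
theorem whitney_eq_iff_whitneyMatrix_eq [Finite E] [Module.Finite F E] {M M' : QMatroid F E}
    {k : ℕ} (hM : M.rank = k) (hM' : M'.rank = k) :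
    M'.whitney = M.whitney ↔
      whitneyMatrix M' k (finrank F E) = whitneyMatrix M k (finrank F E) := by
  constructor
  · intro h
    ext i j
    simp only [whitneyMatrix, Matrix.of_apply]
    -- The second index of `ν` may be negative; there both entries are zero by convention.
    by_cases h0 : 0 ≤ (finrank F E : ℤ) - k + (i : ℕ) - (j : ℕ)
    · obtain ⟨c, hc⟩ := Int.eq_ofNat_of_zero_le h0
      let d : Fin 2 →₀ ℕ := Finsupp.single 0 (i : ℕ) + Finsupp.single 1 c
      have hi : d 0 = i := by simp [d]
      have hj : d 1 = c := by simp [d]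
      have e := coeff_whitney_eq_nu M d
      have e' := coeff_whitney_eq_nu M' d
      rw [hi, hj] at e e'
      rw [hc, ← e, ← e', h]
    · rw [nu, nu, if_neg fun h' => h0 h'.1, if_neg fun h' => h0 h'.1]
  · intro h
    ext d
    by_cases h0 : d 0 ≤ k
    · rw [coeff_whitney_eq_nu, coeff_whitney_eq_nu]
      by_cases h1 : (d 1 : ℤ) ≤ (finrank F E : ℤ) - k
      -- The exponents `(i, j)` sit in column `n - k + i - j` of `N`, which is at most `n` because
      -- `i ≤ k`.
      · have e := congrFun (congrFun h ⟨d 0, by omega⟩)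
          ⟨finrank F E - k + d 0 - d 1, by omega⟩
        simp only [whitneyMatrix, Matrix.of_apply] at e
        have e1 : (finrank F E : ℤ) - k + (d 0 : ℕ) - (finrank F E - k + d 0 - d 1 : ℕ) = d 1 := by
          omega
        rwa [e1] at e
      · simp [nu, h1, hM, hM']
    · have hz : ∀ M₀ : QMatroid F E, M₀.rank = k → M₀.whitney.coeff d = 0 := by
        intro M₀ hk
        rw [coeff_whitney, Nat.cast_eq_zero, Set.ncard_eq_zero]
        refine Set.eq_empty_of_forall_notMem ?_
        rintro V ⟨hV, -⟩
        omega
      rw [hz M hM, hz M' hM']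

end QMatroid

/-! ### Counting subcodes by weight -/

section Weights

variable {F L : Type*} [Field F] [Field L] [Algebra F L] {m k n : ℕ}

variable (F n) in
/-- The matrix `(δ_{i, dim V})`, `0 ≤ i ≤ n`, `V ≤ F^n`. -/
noncomputable def dimMatrix : Matrix (Fin (n + 1)) (Submodule F (Fin n → F)) ℤ :=
  Matrix.of fun i V => if finrank F V = i then 1 else 0

theorem dimMatrix_mul_supportMatrix [Finite F] (b : Basis (Fin m) F L)
    (C : Submodule L (Fin n → L)) :
    dimMatrix F n * supportMatrix b C k = weightMatrix b C k := by
  have : Module.Finite F L := Module.Finite.of_basis b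
  have : Finite L := Module.finite_of_finite F
  ext i t
  rw [Matrix.mul_apply]
  simp only [dimMatrix, supportMatrix, supportDist, weightMatrix, weightDist, wtSpace,
    Matrix.of_apply, ite_mul, one_mul, zero_mul]
  rw [← Finset.sum_filter]
  have h := sum_ncard_fiber (subcodes C t) (suppSpace b)
    (Finset.univ.filter fun W => finrank F W = i)
  simp only [Finset.mem_filter, Finset.mem_univ, true_and] at h
  exact_mod_cast h

/-- In column `W`, all `V ≥ W` of dimension `i` carry the same Möbius value, and there are `[n - w,
i - w]_q` of them, where `w = dim W`. So the column depends on `W` only through `w`. -/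
theorem dimMatrix_mul_moebiusMatrix [Finite F] :
    dimMatrix F n * moebiusMatrix F (Fin n → F) = fMatrix (Nat.card F) n * dimMatrix F n := by
  classical
  ext i W
  have hW : finrank F W < n + 1 :=
    Nat.lt_succ_of_le ((Submodule.finrank_le W).trans (finrank_fin_fun F).le)
  have hr : (fMatrix (Nat.card F) n * dimMatrix F n) i W =
      fMatrix (Nat.card F) n i ⟨finrank F W, hW⟩ := by
    rw [Matrix.mul_apply, Finset.sum_eq_single ⟨finrank F W, hW⟩]
    · simp [dimMatrix]
    · intro j _ hj
      have : ¬ finrank F W = j := fun h => hj (Fin.ext h.symm)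
      simp [dimMatrix, this]
    · simp
  rw [hr, Matrix.mul_apply]
  simp only [dimMatrix, moebiusMatrix, moebius, fMatrix, Matrix.of_apply, ite_mul, one_mul,
    zero_mul, ← ite_and]
  by_cases h : finrank F W ≤ i
  · rw [if_pos (show (⟨finrank F W, hW⟩ : Fin (n + 1)) ≤ i from h)]
    have hcount := ncard_ge_finrank_eq W ((i : ℕ) - finrank F W)
    rw [finrank_fin_fun, Nat.add_sub_cancel' h] at hcount
    rw [← hcount, ← Finset.sum_filter, Finset.sum_congr rfl
      (g := fun _ => (-1 : ℤ) ^ ((i : ℕ) - finrank F W) *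
        (Nat.card F : ℤ) ^ ((i : ℕ) - finrank F W).choose 2) fun V hV => by
          rw [(Finset.mem_filter.mp hV).2.1], Finset.sum_const, nsmul_eq_mul, mul_comm,
      ← Set.ncard_coe_finset]
    congr 3
    ext V
    simp [and_comm]
  · rw [if_neg (show ¬ (⟨finrank F W, hW⟩ : Fin (n + 1)) ≤ i from h)]
    refine Finset.sum_eq_zero fun V _ => if_neg ?_
    rintro ⟨h1, h2⟩
    exact h (h1 ▸ Submodule.finrank_mono h2)

/-- The entry at `(j, l)` counts the `W` with `dim W = j` and `ρ(W^⊥) = k - l`. Put `V = W^⊥`: then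
`dim V = n - j = (k - l) + (n - k + l - j)`, which is the index shift in `N`. -/
theorem dimMatrix_mul_perpMatrix_mul_rankMatrix [Finite F] {M : QMatroid F (Fin n → F)}
    (hM : M.rank = k) :
    dimMatrix F n * (perpMatrix (dotForm F n) * rankMatrix M k) =
      (whitneyMatrix M k n).transpose := by
  classical
  ext j l
  rw [Matrix.mul_apply, Matrix.transpose_apply]
  simp only [perpMatrix_mul_apply]
  simp only [dimMatrix, rankMatrix, whitneyMatrix, Matrix.of_apply, ite_mul, one_mul, zero_mul,
    ← ite_and, QMatroid.nu_eq_ncard]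
  rw [Finset.sum_boole, ← Set.ncard_coe_finset,
    ← Set.ncard_image_of_injective _ (Function.LeftInverse.injective (perp_perp (K := F) (n := n)))]
  congr 2
  ext V
  simp only [Finset.coe_filter, Finset.mem_univ, true_and, Set.mem_image, Set.mem_ofPred_eq]
  have hn := (Submodule.finrank_le V).trans (finrank_fin_fun F).le
  constructor
  · rintro ⟨W, ⟨h1, h2⟩, rfl⟩
    have hW := (Submodule.finrank_le W).trans (finrank_fin_fun F).le
    have hd := finrank_perp W
    omega
  · rintro ⟨h1, h2⟩
    refine ⟨(dotForm F n).orthogonal V, ⟨?_, ?_⟩, perp_perp V⟩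
    · rw [finrank_perp]
      omega
    · rw [perp_perp]
      omega

theorem weightMatrix_eq [Finite F] (b : Basis (Fin m) F L)
    {G : Matrix (Fin k) (Fin n) L} (hG : G.rank = k) :
    weightMatrix b (rowsp G) k = fMatrix (Nat.card F) n *
      (whitneyMatrix (represented F G) k n).transpose * qMatrix (Nat.card F ^ m) k := by
  rw [← dimMatrix_mul_supportMatrix, supportMatrix_eq b hG,
    ← dimMatrix_mul_perpMatrix_mul_rankMatrix ((represented_rank F G).trans hG)]
  simp only [← Matrix.mul_assoc, dimMatrix_mul_moebiusMatrix]

end Weights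

/-! ### Mutual determination -/

section Determination

variable {F L : Type*} [Field F] [Field L] [Algebra F L] {m k n : ℕ}

theorem represented_eq_iff_rankMatrix_eq {G G' : Matrix (Fin k) (Fin n) L} :
    represented F G' = represented F G ↔
      rankMatrix (represented F G') k = rankMatrix (represented F G) k := by
  refine ⟨fun h => by rw [h], fun h => QMatroid.ext (funext fun V => ?_)⟩
  have h1 := represented_rk_le G V
  have h2 := represented_rk_le G' V
  -- In row `V` the matrix of `G` has its only `1` in this column, which forces the two ranks of `V`
  -- to agree.
  have e := congrFun (congrFun h V) ⟨k - (represented F G).rk V, by omega⟩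
  simp only [rankMatrix, Matrix.of_apply, Nat.cast_sub h1, if_true] at e
  have := (ite_eq_left_iff.mp e)
  by_contra hne
  exact zero_ne_one (this fun h' => hne (by omega))

theorem supportMatrix_eq_iff (b : Basis (Fin m) F L) {C C' : Submodule L (Fin n → L)} :
    supportMatrix b C' k = supportMatrix b C k ↔
      ∀ t ≤ k, ∀ V, supportDist b C' t V = supportDist b C t V := by
  constructor
  · intro h t ht V
    exact Nat.cast_injective (R := ℤ) (congrFun (congrFun h V) ⟨t, Nat.lt_succ_of_le ht⟩)
  · intro h
    ext V t
    exact congrArg _ (h t (Nat.le_of_lt_succ t.2) V)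

theorem weightMatrix_eq_iff (b : Basis (Fin m) F L) {C C' : Submodule L (Fin n → L)} :
    weightMatrix b C' k = weightMatrix b C k ↔
      ∀ t ≤ k, ∀ i ≤ n, weightDist b C' t i = weightDist b C t i := by
  constructor
  · intro h t ht i hi
    exact Nat.cast_injective (R := ℤ)
      (congrFun (congrFun h ⟨i, Nat.lt_succ_of_le hi⟩) ⟨t, Nat.lt_succ_of_le ht⟩)
  · intro h
    ext i t
    exact congrArg _ (h t (Nat.le_of_lt_succ t.2) i (Nat.le_of_lt_succ i.2))

variable [Finite F]

theorem rankMatrix_eq (b : Basis (Fin m) F L) {G : Matrix (Fin k) (Fin n) L} (hG : G.rank = k) :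
    rankMatrix (represented F G) k = perpMatrix (dotForm F n) *
      (moebiusMatrix F (Fin n → F))⁻¹ * supportMatrix b (rowsp G) k *
        (qMatrix (Nat.card F ^ m) k)⁻¹ := by
  have hM := (Matrix.isUnit_iff_isUnit_det _).mp (isUnit_moebiusMatrix (F := F) (E := Fin n → F))
  have hQ := (Matrix.isUnit_iff_isUnit_det _).mp (isUnit_qMatrix (Nat.card F ^ m) k)
  rw [supportMatrix_eq b hG]
  simp only [Matrix.mul_assoc]
  rw [Matrix.mul_nonsing_inv _ hQ, Matrix.mul_one, Matrix.nonsing_inv_mul_cancel_left _ _ hM,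
    ← Matrix.mul_assoc, perpMatrix_mul_perpMatrix, Matrix.one_mul]

theorem whitneyMatrix_transpose_eq (b : Basis (Fin m) F L) {G : Matrix (Fin k) (Fin n) L}
    (hG : G.rank = k) :
    (whitneyMatrix (represented F G) k n).transpose = (fMatrix (Nat.card F) n)⁻¹ *
      weightMatrix b (rowsp G) k * (qMatrix (Nat.card F ^ m) k)⁻¹ := by
  have hF := (Matrix.isUnit_iff_isUnit_det _).mp (isUnit_fMatrix (Nat.card F) n)
  have hQ := (Matrix.isUnit_iff_isUnit_det _).mp (isUnit_qMatrix (Nat.card F ^ m) k)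
  rw [weightMatrix_eq b hG]
  simp only [Matrix.mul_assoc]
  rw [Matrix.mul_nonsing_inv _ hQ, Matrix.mul_one, Matrix.nonsing_inv_mul_cancel_left _ _ hF]

theorem represented_eq_iff_supportDist_eq (b : Basis (Fin m) F L) {k' : ℕ}
    {G : Matrix (Fin k) (Fin n) L} {G' : Matrix (Fin k') (Fin n) L}
    (hG : G.rank = k) (hG' : G'.rank = k') :
    represented F G' = represented F G ↔
      k' = k ∧ ∀ t ≤ k, ∀ V : Submodule F (Fin n → F),
        supportDist b (rowsp G') t V = supportDist b (rowsp G) t V := by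
  by_cases hk : k' = k
  · subst hk
    rw [← supportMatrix_eq_iff, represented_eq_iff_rankMatrix_eq]
    refine ⟨fun h => ⟨rfl, ?_⟩, fun h => ?_⟩
    · rw [supportMatrix_eq b hG, supportMatrix_eq b hG', h]
    · rw [rankMatrix_eq b hG, rankMatrix_eq b hG', h.2]
  · refine ⟨fun h => absurd ?_ hk, fun h => absurd h.1 hk⟩
    rw [← hG, ← hG', ← represented_rank F G, ← represented_rank F G', h]

theorem whitney_eq_iff_weightDist_eq (b : Basis (Fin m) F L) {k' : ℕ}
    {G : Matrix (Fin k) (Fin n) L} {G' : Matrix (Fin k') (Fin n) L}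
    (hG : G.rank = k) (hG' : G'.rank = k') :
    (represented F G').whitney = (represented F G).whitney ↔
      k' = k ∧ ∀ t ≤ k, ∀ i ≤ n,
        weightDist b (rowsp G') t i = weightDist b (rowsp G) t i := by
  have hr := (represented_rank F G).trans hG
  have hr' := (represented_rank F G').trans hG'
  by_cases hk : k' = k
  · subst hk
    rw [← weightMatrix_eq_iff, QMatroid.whitney_eq_iff_whitneyMatrix_eq hr hr', finrank_fin_fun]
    refine ⟨fun h => ⟨rfl, ?_⟩, fun h => Matrix.transpose_injective ?_⟩
    · rw [weightMatrix_eq b hG, weightMatrix_eq b hG', h]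
    · rw [whitneyMatrix_transpose_eq b hG, whitneyMatrix_transpose_eq b hG', h.2]
  · refine ⟨fun h => absurd ?_ hk, fun h => absurd h.1 hk⟩
    -- The Whitney function alone determines the rank, so different `k` and `k'` cannot share one.
    rw [← hr, ← hr', QMatroid.rank_eq_of_whitney_eq h]

end Determination

end RankMetric

open RankMetric in
theorem mainTheorem1 {F L : Type*} [Field F] [Finite F] [Field L] [Algebra F L]
    (q m k n : ℕ) (hq : Nat.card F = q) (b : Module.Basis (Fin m) F L)
    (G : Matrix (Fin k) (Fin n) L) (hG : G.rank = k)
    (M P : Matrix (Submodule F (Fin n → F)) (Submodule F (Fin n → F)) ℤ)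
    (hM : M = moebiusMatrix F (Fin n → F))
    (hP : P = perpMatrix (dotProductBilin F F : LinearMap.BilinForm F (Fin n → F)))
    (Φ : Matrix (Fin (n + 1)) (Fin (n + 1)) ℤ) (hΦ : Φ = fMatrix q n)
    (Q : Matrix (Fin (k + 1)) (Fin (k + 1)) ℤ) (hQ : Q = qMatrix (q ^ m) k)
    (K S : Matrix (Submodule F (Fin n → F)) (Fin (k + 1)) ℤ)
    (hK : K = rankMatrix (represented F G) k)
    (hS : S = supportMatrix b (rowsp G) k)
    (N : Matrix (Fin (k + 1)) (Fin (n + 1)) ℤ)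
    (hN : N = whitneyMatrix (represented F G) k n)
    (A : Matrix (Fin (n + 1)) (Fin (k + 1)) ℤ)
    (hA : A = weightMatrix b (rowsp G) k) :
    -- the matrices that do not depend on the code are invertible over the integers
    (IsUnit M ∧ P * P = 1 ∧ IsUnit Φ ∧ IsUnit Q) ∧
    -- (a)
    (S = M * P * K * Q ∧ K = P * M⁻¹ * S * Q⁻¹ ∧
      ∀ (k' : ℕ) (G' : Matrix (Fin k') (Fin n) L), G'.rank = k' →
        (represented F G' = represented F G ↔
          k' = k ∧ ∀ t ≤ k, ∀ V : Submodule F (Fin n → F),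
            supportDist b (rowsp G') t V = supportDist b (rowsp G) t V)) ∧
    -- (b)
    (A = Φ * N.transpose * Q ∧ N.transpose = Φ⁻¹ * A * Q⁻¹ ∧
      ∀ (k' : ℕ) (G' : Matrix (Fin k') (Fin n) L), G'.rank = k' →
        ((represented F G').whitney = (represented F G).whitney ↔
          k' = k ∧ ∀ t ≤ k, ∀ i ≤ n,
            weightDist b (rowsp G') t i = weightDist b (rowsp G) t i)) := by
  subst hq hM hP hΦ hQ hK hS hN hA
  exact ⟨⟨isUnit_moebiusMatrix, perpMatrix_mul_perpMatrix, isUnit_fMatrix _ _,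
      isUnit_qMatrix _ _⟩,
    ⟨supportMatrix_eq b hG, rankMatrix_eq b hG,
      fun _ _ hG' => represented_eq_iff_supportDist_eq b hG hG'⟩,
    ⟨weightMatrix_eq b hG, whitneyMatrix_transpose_eq b hG,
      fun _ _ hG' => whitney_eq_iff_weightDist_eq b hG hG'⟩⟩
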